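/- Let $R$ be a commutative noetherian ring and let $\Lambda$ be an $R$-algebra (associative, with unit, $R$ acting through the center of $\Lambda$) that is finitely generated as an $R$-module. "Module" means right module and "ideal" means two-sided ideal. A proper ideal $P$ of $\Lambda$ is prime if $a\Lambda b\subseteq P$ implies $a\in P$ or $b\in P$; let $\operatorname{Max}\Lambda$ be the set of maximal ideals of $\Lambda$, all of which are prime. A nonzero $\Lambda$-module $H$ is monoform if for every nonzero submodule $N$ of $H$ no nonzero submodule of $H$ is isomorphic to a submodule of $H/N$. Two monoform modules are atom-equivalent if they have isomorphic nonzero submodules; this is an equivalence relation, its classes are called atoms, and $\overline{H}$ denotes the class of $H$. Every simple module is monoform. To a prime ideal $P$ one attaches an atom $\widetilde{P}$ as follows: the injective hull of the $\Lambda$-module $\Lambda/P$ is a direct sum of finitely many copies of an indecomposable injective module $I(P)$, and $\widetilde{P}$ is the unique atom $\overline{H}$ such that $I(P)$ is an injective hull of $H$; it is well defined and depends only on $P$. Then $P\mapsto\widetilde{P}$ restricts to a bijection from $\operatorname{Max}\Lambda$ onto the set of atoms that are represented by simple $\Lambda$-modules. Consequently there is a bijection from $\operatorname{Max}\Lambda$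 onto the set of isomorphism classes of simple $\Lambda$-modules, sending a maximal ideal $P$ to the class of a simple module $S$ with $\overline{S}=\widetilde{P}$. -/

import Mathlib

universe u v

namespace NoethAlg

section Atoms

variable (A : Type u) [Ring A]

/-- `M` and `N` have a common nonzero submodule: some nonzero submodule of `M` is isomorphic to a
submodule of `N`. -/
def HasCommonSub (M N : Type v) [AddCommGroup M] [Module A M] [AddCommGroup N] [Module A N] :
    Prop :=
  ∃ L : Submodule A M, L ≠ ⊥ ∧ ∃ L' : Submodule A N, Nonempty (L ≃ₗ[A] L')

/-- A nonzero module `H` is monoform if for every nonzero submodule `N` of `H` there is no common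
nonzero submodule of `H` and `H ⧸ N`. -/
def IsMonoform (H : Type v) [AddCommGroup H] [Module A H] : Prop :=
  Nontrivial H ∧ ∀ N : Submodule A H, N ≠ ⊥ → ¬ HasCommonSub A H (H ⧸ N)

variable {A}

theorem hasCommonSub_iff_exists_injective {M N : Type v} [AddCommGroup M] [Module A M]
    [AddCommGroup N] [Module A N] :
    HasCommonSub A M N ↔
      ∃ L : Submodule A M, L ≠ ⊥ ∧ ∃ f : L →ₗ[A] N, Function.Injective f := by
  constructor
  · rintro ⟨L, hL, L', ⟨e⟩⟩
    exact ⟨L, hL, L'.subtype ∘ₗ e.toLinearMap, L'.injective_subtype.comp e.injective⟩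
  · rintro ⟨L, hL, f, hf⟩
    exact ⟨L, hL, LinearMap.range f, ⟨LinearEquiv.ofInjective f hf⟩⟩

theorem HasCommonSub.symm {M N : Type v} [AddCommGroup M] [Module A M]
    [AddCommGroup N] [Module A N] (h : HasCommonSub A M N) : HasCommonSub A N M := by
  obtain ⟨L, hL, L', ⟨e⟩⟩ := h
  refine ⟨L', ?_, L, ⟨e.symm⟩⟩
  rintro rfl
  apply hL
  rw [← Submodule.subsingleton_iff_eq_bot]
  exact e.toEquiv.subsingleton

theorem hasCommonSub_self {M : Type v} [AddCommGroup M] [Module A M] [Nontrivial M] :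
    HasCommonSub A M M :=
  ⟨⊤, top_ne_bot, ⊤, ⟨LinearEquiv.refl A _⟩⟩

/-- Monoform modules are uniform. -/
theorem IsMonoform.inf_ne_bot {H : Type v} [AddCommGroup H] [Module A H] (h : IsMonoform A H)
    {N K : Submodule A H} (hN : N ≠ ⊥) (hK : K ≠ ⊥) : N ⊓ K ≠ ⊥ := by
  intro hNK
  refine h.2 N hN (hasCommonSub_iff_exists_injective.2 ⟨K, hK, N.mkQ ∘ₗ K.subtype, ?_⟩)
  rw [← LinearMap.ker_eq_bot, LinearMap.ker_comp, Submodule.ker_mkQ, Submodule.eq_bot_iff]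
  intro x hx
  have : (x : H) ∈ N ⊓ K := ⟨hx, x.2⟩
  rw [hNK] at this
  exact Subtype.ext ((Submodule.mem_bot A).1 this)

theorem HasCommonSub.trans {M H N : Type v} [AddCommGroup M] [Module A M]
    [AddCommGroup H] [Module A H] [AddCommGroup N] [Module A N] (hH : IsMonoform A H)
    (h₁ : HasCommonSub A M H) (h₂ : HasCommonSub A H N) : HasCommonSub A M N := by
  obtain ⟨L, hL, f, hf⟩ := hasCommonSub_iff_exists_injective.1 h₁.symm
  obtain ⟨K, hK, g, hg⟩ := hasCommonSub_iff_exists_injective.1 h₂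
  have hLK := hH.inf_ne_bot hL hK
  have h₃ : HasCommonSub A M (L ⊓ K : Submodule A H) := by
    apply HasCommonSub.symm
    refine hasCommonSub_iff_exists_injective.2 ⟨⊤, ?_,
      f ∘ₗ Submodule.inclusion inf_le_left ∘ₗ Submodule.subtype ⊤, ?_⟩
    · have := Submodule.nontrivial_iff_ne_bot.2 hLK
      exact top_ne_bot
    · exact hf.comp ((Submodule.inclusion_injective inf_le_left).comp (Submodule.injective_subtype _))
  obtain ⟨T, hT, k, hk⟩ := hasCommonSub_iff_exists_injective.1 h₃
  exact hasCommonSub_iff_exists_injective.2 ⟨T, hT, g ∘ₗ Submodule.inclusion inf_le_right ∘ₗ k,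
    hg.comp ((Submodule.inclusion_injective inf_le_right).comp hk)⟩

theorem isMonoform_of_isSimpleModule {S : Type v} [AddCommGroup S] [Module A S]
    (h : IsSimpleModule A S) : IsMonoform A S := by
  refine ⟨IsSimpleModule.nontrivial A S, ?_⟩
  intro N hN hc
  obtain rfl := (eq_bot_or_eq_top N).resolve_left hN
  obtain ⟨L, hL, -⟩ := hc.symm
  exact hL (Subsingleton.elim _ _)

variable (A)

/-- The monoform objects of the category of `A`-modules. -/
abbrev MonoformModule : Type (u + 1) := {H : ModuleCat.{u} A // IsMonoform A H}

/-- Atom equivalence of monoform modules. -/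
def atomSetoid : Setoid (MonoformModule A) where
  r H H' := HasCommonSub A H.1 H'.1
  iseqv :=
    { refl := fun H => by
        have := H.2.1
        exact hasCommonSub_self
      symm := fun h => h.symm
      trans := fun {_ H' _} h₁ h₂ => HasCommonSub.trans H'.2 h₁ h₂ }

/-- The atom spectrum of the category of `A`-modules. -/
def ASpec : Type (u + 1) := Quotient (atomSetoid A)

variable {A}

/-- The atom represented by a monoform module. -/
def MonoformModule.atom (H : MonoformModule A) : ASpec A := Quotient.mk (atomSetoid A) H

variable (A)

/-- The atoms that are represented by simple modules. -/
def simpleAtoms : Set (ASpec A) :=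
  {α | ∃ H : MonoformModule A, IsSimpleModule A H.1 ∧ H.atom = α}

/-- Isomorphism of simple modules. -/
def simpleSetoid : Setoid {S : ModuleCat.{u} A // IsSimpleModule A S} where
  r S T := Nonempty (S.1 ≃ₗ[A] T.1)
  iseqv :=
    { refl := fun S => ⟨LinearEquiv.refl A S.1⟩
      symm := fun ⟨e⟩ => ⟨e.symm⟩
      trans := fun ⟨e⟩ ⟨e'⟩ => ⟨e.trans e'⟩ }

/-- The isomorphism classes of simple modules. -/
def SimpleClass : Type (u + 1) := Quotient (simpleSetoid A)

variable {A}

/-- The atom represented by an isomorphism class of simple modules. -/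
def SimpleClass.atom : SimpleClass A → ASpec A :=
  Quotient.lift
    (fun S => MonoformModule.atom ⟨S.1, isMonoform_of_isSimpleModule S.2⟩)
    (by
      rintro S T ⟨e⟩
      refine Quotient.sound (s := atomSetoid A) ?_
      have := (isMonoform_of_isSimpleModule S.2).1
      exact hasCommonSub_iff_exists_injective.2
        ⟨⊤, top_ne_bot, e.toLinearMap ∘ₗ Submodule.subtype ⊤,
          e.injective.comp (Submodule.injective_subtype _)⟩)

variable (A)

/-- `E` is (isomorphic to) the injective hull of `M`: it is injective and `M` embeds in it as an
essential submodule. -/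
def IsInjectiveHull (M E : Type u) [AddCommGroup M] [Module A M] [AddCommGroup E] [Module A E] :
    Prop :=
  Module.Injective A E ∧ ∃ f : M →ₗ[A] E, Function.Injective f ∧
    ∀ N : Submodule A E, N ⊓ LinearMap.range f = ⊥ → N = ⊥

/-- A nonzero module that is not the direct sum of two nonzero submodules. -/
def IsIndecomposable (M : Type u) [AddCommGroup M] [Module A M] : Prop :=
  Nontrivial M ∧ ∀ N K : Submodule A M, IsCompl N K → N = ⊥ ∨ K = ⊥

variable {A}

/-- `E` is the injective hull of (a representative of) the atom `α`. -/
def IsAtomHull (α : ASpec A) (E : ModuleCat.{u} A) : Prop :=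
  ∃ H : MonoformModule A, H.atom = α ∧ IsInjectiveHull A H.1 E

end Atoms

section Ideals

variable {Λ : Type u} [Ring Λ]

/-- A proper two-sided ideal `P` such that `aΛb ⊆ P` implies `a ∈ P` or `b ∈ P`. -/
def IsPrimeIdeal (P : TwoSidedIdeal Λ) : Prop :=
  P ≠ ⊤ ∧ ∀ a b : Λ, (∀ x : Λ, a * x * b ∈ P) → a ∈ P ∨ b ∈ P

variable (Λ) in
/-- The set of prime two-sided ideals. -/
abbrev PrimeSpec : Type u := {P : TwoSidedIdeal Λ // IsPrimeIdeal P}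

variable (Λ) in
/-- The set of maximal two-sided ideals: the maximal elements among the proper ones. -/
abbrev MaxSpec : Type u := {P : TwoSidedIdeal Λ // IsCoatom P}

theorem isPrimeIdeal_of_isCoatom {P : TwoSidedIdeal Λ} (hP : IsCoatom P) : IsPrimeIdeal P := by
  refine ⟨hP.1, fun a b hab => ?_⟩
  let J : TwoSidedIdeal Λ := TwoSidedIdeal.mk' {x | ∀ y : Λ, x * y * b ∈ P}
    (fun y => by simp [P.zero_mem])
    (fun {x z} hx hz y => by simpa [add_mul] using P.add_mem (hx y) (hz y))
    (fun {x} hx y => by simpa using P.neg_mem (hx y))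
    (fun {x z} hz y => by simpa [mul_assoc] using P.mul_mem_left x _ (hz y))
    (fun {x z} hx y => by simpa [mul_assoc] using hx (z * y))
  have hJ : ∀ x, x ∈ J ↔ ∀ y : Λ, x * y * b ∈ P := fun x => TwoSidedIdeal.mem_mk' ..
  have hPJ : P ≤ J := fun x hx =>
    (hJ x).2 fun y => P.mul_mem_right _ _ (P.mul_mem_right _ _ hx)
  by_cases ha : a ∈ P
  · exact Or.inl ha
  · have hlt : P < J := lt_of_le_of_ne hPJ fun h => ha (by rw [h]; exact (hJ a).2 hab)
    have h1 : (1 : Λ) ∈ J := by rw [hP.2 J hlt]; exact TwoSidedIdeal.mem_top Λ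
    exact Or.inr (by simpa using (hJ 1).1 h1 1)

/-- A maximal ideal, regarded as a prime ideal. -/
def MaxSpec.toPrimeSpec (P : MaxSpec Λ) : PrimeSpec Λ := ⟨P.1, isPrimeIdeal_of_isCoatom P.2⟩

/-- A two-sided ideal as a submodule of the right module `Λ`.  Right `Λ`-modules are modules
over `Λᵐᵒᵖ`. -/
def rightSubmodule (P : TwoSidedIdeal Λ) : Submodule Λᵐᵒᵖ Λ where
  carrier := P
  add_mem' := P.add_mem
  zero_mem' := P.zero_mem
  smul_mem' c _ hx := P.mul_mem_right _ c.unop hx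

/-- `I` is an indecomposable injective right module `I(P)` attached to the ideal `P`:
the injective hull of the right module `Λ ⧸ P` is a direct sum of finitely many copies of `I`. -/
def IsIndecInjectiveOf (P : TwoSidedIdeal Λ) (I : ModuleCat.{u} Λᵐᵒᵖ) : Prop :=
  Module.Injective Λᵐᵒᵖ I ∧ IsIndecomposable Λᵐᵒᵖ I ∧
    ∃ n : ℕ, IsInjectiveHull Λᵐᵒᵖ (Λ ⧸ rightSubmodule P) (Fin n → I)

/-- The atom `α` corresponds to the prime ideal `P` when the indecomposable injective module
`I(P)` is the injective hull of `α`. -/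
def AtomCorresponds (P : PrimeSpec Λ) (α : ASpec Λᵐᵒᵖ) : Prop :=
  ∃ I : ModuleCat.{u} Λᵐᵒᵖ, IsIndecInjectiveOf P.1 I ∧ IsAtomHull α I

end Ideals

end NoethAlg

/-! The right module Λ/P is noetherian, hence has a nonzero uniform submodule U. Primeness gives
`IsPrimeIdeal.nonsingular`: no nonzero element of Λ/P has an essential right annihilator. It follows
that U is monoform and that every nonzero submodule of Λ/P has a nonzero submodule embedding in U.
So the injective hull of U serves as I(P), a finite power of it being a hull of Λ/P, and any other
choice of I(P) leads to the same atom, that of U (`exists_submodule_atomCorresponds_iff`).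

For a simple module S, finiteness over R embeds Λ/ann S in a finite power of S
(`exists_embedding_pi_of_simple`). Thus Λ/ann S is semisimple and all its simple submodules are
copies of S. This forces ann S to be maximal, and it puts a copy of S inside U, so the atom attached
to ann S is that of S. Every maximal ideal is the annihilator of a simple module, so S ↦ ann S
inverts the correspondence. -/

namespace NoethAlg

/-! ### Essential and uniform submodules. -/

section Essential

variable {A : Type u} [Ring A]

/-- A submodule is essential if every nonzero element has a nonzero multiple in it. -/
def IsEssential {M : Type v} [AddCommGroup M] [Module A M] (X : Submodule A M) : Prop :=
  ∀ x : M, x ≠ 0 → ∃ a : A, a • x ≠ 0 ∧ a • x ∈ X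

theorem isEssential_iff {M : Type v} [AddCommGroup M] [Module A M] {X : Submodule A M} :
    IsEssential X ↔ ∀ N : Submodule A M, N ⊓ X = ⊥ → N = ⊥ := by
  constructor
  · intro h N hN
    rw [Submodule.eq_bot_iff]
    intro x hx
    by_contra hx0
    obtain ⟨a, ha, haX⟩ := h x hx0
    have : a • x ∈ N ⊓ X := ⟨N.smul_mem a hx, haX⟩
    rw [hN] at this
    exact ha this
  · intro h x hx
    by_contra! hc
    refine hx (Submodule.span_singleton_eq_bot.1 (h (A ∙ x) ?_))
    rw [Submodule.eq_bot_iff]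
    rintro y ⟨hy, hyX⟩
    obtain ⟨a, rfl⟩ := Submodule.mem_span_singleton.1 hy
    by_contra h0
    exact hc a h0 hyX

variable (A) in
/-- A module is uniform if all its nonzero submodules are essential. -/
def IsUniform (M : Type v) [AddCommGroup M] [Module A M] : Prop :=
  ∀ X : Submodule A M, X ≠ ⊥ → IsEssential X

/-- Uniformity passes to essential extensions, in particular from U to its injective hull: a nonzero
submodule of E pulls back to a nonzero submodule of U. -/
theorem IsUniform.of_essential {U E : Type v} [AddCommGroup U] [Module A U] [AddCommGroup E]
    [Module A E] (hU : IsUniform A U) {f : U →ₗ[A] E} (hf : Function.Injective f)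
    (he : IsEssential (LinearMap.range f)) : IsUniform A E := by
  intro X hX y hy
  have hX' : X.comap f ≠ ⊥ := by
    obtain ⟨x, hx, hx0⟩ := X.exists_mem_ne_zero_of_ne_bot hX
    obtain ⟨a, ha, u, hu⟩ := he x hx0
    refine (Submodule.ne_bot_iff _).2 ⟨u, ?_, ?_⟩
    · rw [Submodule.mem_comap, hu]
      exact X.smul_mem a hx
    · rintro rfl
      exact ha (by simpa using hu.symm)
  obtain ⟨a, ha, v, hv⟩ := he y hy
  have hv0 : v ≠ 0 := by
    rintro rfl
    exact ha (by simpa using hv.symm)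
  obtain ⟨b, hb, hbX⟩ := hU _ hX' v hv0
  have key : (b * a) • y = f (b • v) := by rw [mul_smul, ← hv, map_smul]
  exact ⟨b * a, by rw [key]; exact (map_ne_zero_iff f hf).2 hb, by rw [key]; exact hbX⟩

theorem IsUniform.isIndecomposable {M : Type u} [AddCommGroup M] [Module A M] [Nontrivial M]
    (hM : IsUniform A M) : IsIndecomposable A M := by
  refine ⟨inferInstance, fun N K h => or_iff_not_imp_right.2 fun hK => ?_⟩
  exact isEssential_iff.1 (hM K hK) N h.inf_eq_bot

/-- Every nonzero noetherian module has a nonzero uniform submodule. -/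
theorem exists_uniform_submodule (M : Type v) [AddCommGroup M] [Module A M] [IsNoetherian A M]
    [Nontrivial M] : ∃ U : Submodule A M, U ≠ ⊥ ∧ IsUniform A U := by
  -- N is maximal among submodules that miss some nonzero U. If U contained independent nonzero X
  -- and Y, then N ⊔ X would be larger and still miss Y.
  obtain ⟨N, ⟨U, hU, hNU⟩, hmax⟩ := set_has_maximal_iff_noetherian.2 ‹IsNoetherian A M›
    {N : Submodule A M | ∃ K : Submodule A M, K ≠ ⊥ ∧ Disjoint N K}
    ⟨⊥, ⊤, top_ne_bot, disjoint_bot_left⟩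
  refine ⟨U, hU, fun X hX => isEssential_iff.2 fun Y hYX => ?_⟩
  by_contra hY
  have hX' : X.map U.subtype ≠ ⊥ := by
    rwa [Ne, (Submodule.map_injective_of_injective U.injective_subtype).eq_iff' (Submodule.map_bot _)]
  have hY' : Y.map U.subtype ≠ ⊥ := by
    rwa [Ne, (Submodule.map_injective_of_injective U.injective_subtype).eq_iff' (Submodule.map_bot _)]
  have hd : Disjoint (X.map U.subtype) (Y.map U.subtype) := by
    rw [disjoint_iff, ← Submodule.map_inf _ U.injective_subtype, inf_comm, hYX, Submodule.map_bot]
  have hXU : X.map U.subtype ≤ U := Submodule.map_subtype_le U X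
  have hYU : Y.map U.subtype ≤ U := Submodule.map_subtype_le U Y
  refine hmax (N ⊔ X.map U.subtype) ⟨Y.map U.subtype, hY', ?_⟩ ?_
  · exact hd.disjoint_sup_left_of_disjoint_sup_right (hNU.mono_right (sup_le hXU hYU))
  · refine left_lt_sup.2 fun hle => hX' ?_
    exact (hNU.mono_left hle).eq_bot_of_le hXU

end Essential

/-! ### Injective hulls and finite powers of a uniform injective. -/

section Hull

variable {A : Type u} [Ring A]

theorem isInjectiveHull_iff {M E : Type u} [AddCommGroup M] [Module A M] [AddCommGroup E]
    [Module A E] :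
    IsInjectiveHull A M E ↔ Module.Injective A E ∧ ∃ f : M →ₗ[A] E, Function.Injective f ∧
      IsEssential (LinearMap.range f) := by
  simp only [IsInjectiveHull, isEssential_iff]

theorem injective_of_retraction {J : Type u} [AddCommGroup J] [Module A J]
    (hJ : Module.Injective A J) {E : Submodule A J} (r : J →ₗ[A] E)
    (hr : ∀ e : E, r e = e) : Module.Injective A E := by
  refine ⟨fun X Y _ _ _ _ f hf g => ?_⟩
  obtain ⟨h, hh⟩ := hJ.out f hf (E.subtype ∘ₗ g)
  exact ⟨r ∘ₗ h, fun x => by simp [hh, hr]⟩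

theorem exists_injective_embedding (M : Type u) [AddCommGroup M] [Module A M] :
    ∃ (J : ModuleCat.{u} A) (f : M →ₗ[A] J), Module.Injective A J ∧ Function.Injective f := by
  obtain ⟨J, hJ, f, hf⟩ :=
    (CategoryTheory.EnoughInjectives.presentation (ModuleCat.of A M)).some
  exact ⟨J, f.hom, Module.injective_module_of_injective_object A J,
    (ModuleCat.mono_iff_injective f).1 hf⟩

theorem exists_maximal_essential {J : Type u} [AddCommGroup J] [Module A J] (X : Submodule A J) :
    ∃ E : Submodule A J, X ≤ E ∧
      Maximal (fun E : Submodule A J => ∀ x ∈ E, x ≠ 0 → ∃ a : A, a • x ≠ 0 ∧ a • x ∈ X) E := by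
  refine zorn_le_nonempty₀ {E : Submodule A J | ∀ x ∈ E, x ≠ 0 → ∃ a : A, a • x ≠ 0 ∧ a • x ∈ X}
    (fun c hc hchain Y hY => ?_) X fun x hx h0 => ⟨1, by simpa using h0, by simpa using hx⟩
  refine ⟨sSup c, fun x hx => ?_, fun Z hZ => le_sSup hZ⟩
  obtain ⟨Z, hZ, hxZ⟩ := (Submodule.mem_sSup_of_directed ⟨Y, hY⟩ hchain.directedOn).1 hx
  exact hc hZ x hxZ

theorem exists_maximal_disjoint {J : Type u} [AddCommGroup J] [Module A J] (E : Submodule A J) :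
    ∃ N : Submodule A J, Maximal (fun N : Submodule A J => Disjoint E N) N := by
  obtain ⟨N, -, hN⟩ := zorn_le_nonempty₀ {N : Submodule A J | Disjoint E N}
    (fun c hc hchain Y hY => ⟨sSup c, hchain.directedOn.disjoint_sSup_right.2 fun N hN => hc hN,
      fun Z hZ => le_sSup hZ⟩) ⊥ disjoint_bot_right
  exact ⟨N, hN⟩

/-- Existence of injective hulls. -/
theorem exists_isInjectiveHull (M : Type u) [AddCommGroup M] [Module A M] :
    ∃ E : ModuleCat.{u} A, IsInjectiveHull A M E := by
  obtain ⟨J, f, hJ, hf⟩ := exists_injective_embedding (A := A) M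
  obtain ⟨E, hfE, hE⟩ := exists_maximal_essential (LinearMap.range f)
  obtain ⟨N, hN⟩ := exists_maximal_disjoint E
  have hi : Function.Injective (N.mkQ ∘ₗ E.subtype) := by
    rw [← LinearMap.ker_eq_bot, LinearMap.ker_comp, Submodule.ker_mkQ, Submodule.eq_bot_iff]
    intro x hx
    exact Subtype.ext (Submodule.disjoint_def.1 hN.1 x x.2 hx)
  -- Extend the inclusion of E along the embedding E → J/N. The range of the resulting map J → J
  -- contains E and is still essential over M, so maximality of E makes the map a retraction onto E.
  obtain ⟨h, hh⟩ := hJ.out _ hi E.subtype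
  have hh' : ∀ e ∈ E, h (N.mkQ e) = e := fun e he => hh ⟨e, he⟩
  have hrange : ∀ j, h (N.mkQ j) ∈ E := by
    have hle : E ≤ LinearMap.range (h ∘ₗ N.mkQ) := fun e he => ⟨e, hh' e he⟩
    refine fun j => hE.2 ?_ hle ⟨j, rfl⟩
    rintro _ ⟨j, rfl⟩ hj
    have hjN : j ∉ N := by
      intro hjN
      apply hj
      have : N.mkQ j = 0 := by simpa using hjN
      rw [LinearMap.comp_apply, this, map_zero]
    -- Maximality of N produces a nonzero element n + a • j of E, which h fixes and which is
    -- therefore a multiple of the image of j.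
    have hnd : ¬ Disjoint E (N ⊔ A ∙ j) := fun hd =>
      hjN (hN.2 hd le_sup_left (Submodule.mem_sup_right (Submodule.mem_span_singleton_self j)))
    rw [Submodule.disjoint_def] at hnd
    push Not at hnd
    obtain ⟨e, he, hej, he0⟩ := hnd
    obtain ⟨n, hn, z, hz, rfl⟩ := Submodule.mem_sup.1 hej
    obtain ⟨a, rfl⟩ := Submodule.mem_span_singleton.1 hz
    have key : a • (h ∘ₗ N.mkQ) j = n + a • j := by
      have hn0 : N.mkQ n = 0 := by simpa using hn
      rw [← hh' _ he, map_add, hn0, zero_add, map_smul, map_smul, LinearMap.comp_apply]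
    obtain ⟨b, hb, hbf⟩ := hE.1 _ he he0
    exact ⟨b * a, by rwa [mul_smul, key], by rwa [mul_smul, key]⟩
  refine ⟨ModuleCat.of A E, isInjectiveHull_iff.2 ⟨injective_of_retraction hJ
    ((h ∘ₗ N.mkQ).codRestrict E hrange) fun e => Subtype.ext (hh' e e.2),
    f.codRestrict E fun m => hfE ⟨m, rfl⟩, fun x y hxy => hf (congrArg Subtype.val hxy), ?_⟩⟩
  rintro ⟨x, hx⟩ hx0
  obtain ⟨a, ha, m, hm⟩ := hE.1 x hx fun h => hx0 (Subtype.ext h)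
  exact ⟨a, fun h => ha (congrArg Subtype.val h), m, Subtype.ext hm⟩

theorem exists_extension {I M : Type u} [AddCommGroup I] [Module A I] [AddCommGroup M]
    [Module A M] (hI : Module.Injective A I) {C V : Submodule A M} (hCV : Disjoint C V)
    (e : V →ₗ[A] I) : ∃ g : M →ₗ[A] I, (∀ c ∈ C, g c = 0) ∧ ∀ v : V, g v = e v := by
  have hi : Function.Injective (C.mkQ ∘ₗ V.subtype) := by
    rw [← LinearMap.ker_eq_bot, LinearMap.ker_comp, Submodule.ker_mkQ, Submodule.eq_bot_iff]
    intro x hx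
    exact Subtype.ext (Submodule.disjoint_def.1 hCV x hx x.2)
  obtain ⟨g, hg⟩ := hI.out _ hi e
  refine ⟨g ∘ₗ C.mkQ, fun c hc => ?_, hg⟩
  have : C.mkQ c = 0 := by simpa using hc
  rw [LinearMap.comp_apply, this, map_zero]

/-- If every nonzero submodule of a noetherian module `M` has a nonzero submodule embedding in the
uniform injective module `I`, then a finite power of `I` is an injective hull of `M`. -/
theorem exists_isInjectiveHull_pi {I M : Type u} [AddCommGroup I] [Module A I] [AddCommGroup M]
    [Module A M] [IsNoetherian A M] (hI : Module.Injective A I) (hu : IsUniform A I)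
    (h : ∀ K : Submodule A M, K ≠ ⊥ → ∃ V ≤ K, V ≠ ⊥ ∧ ∃ e : V →ₗ[A] I, Function.Injective e) :
    ∃ n : ℕ, IsInjectiveHull A M (Fin n → I) := by
  -- C is maximal among submodules mapped injectively onto an essential submodule of some power of I
  -- by a map defined on all of M. A nonzero kernel would contain some V embedding in I, and a new
  -- coordinate that kills C and embeds V would enlarge C to C ⊔ V.
  obtain ⟨C, ⟨n, f, hf, hC⟩, hmax⟩ := set_has_maximal_iff_noetherian.2 ‹IsNoetherian A M›
    {C : Submodule A M | ∃ (n : ℕ) (f : M →ₗ[A] (Fin n → I)),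
      Disjoint C (LinearMap.ker f) ∧ IsEssential (C.map f)}
    ⟨⊥, 0, 0, disjoint_bot_left, fun x hx => (hx (Subsingleton.elim _ _)).elim⟩
  refine ⟨n, isInjectiveHull_iff.2 ⟨inferInstance, f, ?_, fun x hx => ?_⟩⟩
  · rw [← LinearMap.ker_eq_bot]
    by_contra hK
    obtain ⟨V, hVK, hV, e, he⟩ := h _ hK
    have hCV : Disjoint C V := hf.mono_right hVK
    obtain ⟨g, hgC, hgV⟩ := exists_extension hI hCV e
    have hfV : ∀ v ∈ V, f v = 0 := fun v hv => hVK hv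
    have hgVe : IsEssential (V.map g) := by
      refine hu _ ?_
      obtain ⟨v, hv, hv0⟩ := V.exists_mem_ne_zero_of_ne_bot hV
      refine (Submodule.ne_bot_iff _).2 ⟨g v, Submodule.mem_map_of_mem hv, ?_⟩
      rw [hgV ⟨v, hv⟩]
      exact (map_ne_zero_iff e he).2 fun h0 => hv0 (congrArg Subtype.val h0)
    let F : M →ₗ[A] (Fin (n + 1) → I) :=
      LinearMap.pi (Fin.cons (α := fun _ => M →ₗ[A] I) g fun i => LinearMap.proj i ∘ₗ f)
    have hF0 : ∀ m, F m 0 = g m := fun m => rfl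
    have hFs : ∀ m i, F m (Fin.succ i) = f m i := fun m i => rfl
    refine hmax (C ⊔ V) ⟨n + 1, F, ?_, ?_⟩ ?_
    · rw [Submodule.disjoint_def]
      intro x hx hFx
      rw [LinearMap.mem_ker] at hFx
      obtain ⟨c, hc, v, hv, rfl⟩ := Submodule.mem_sup.1 hx
      have h1 : f c = 0 := by
        funext i
        have := hFs (c + v) i
        rw [hFx, map_add, hfV v hv, add_zero] at this
        exact this.symm
      have hc0 : c = 0 := Submodule.disjoint_def.1 hf c hc h1
      have h2 := hF0 (c + v)
      rw [hFx, map_add, hgC c hc, zero_add, hgV ⟨v, hv⟩] at h2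
      have h3 : (⟨v, hv⟩ : V) = 0 := he (by rw [map_zero]; exact h2.symm)
      rw [hc0, zero_add]
      exact congrArg Subtype.val h3
    · have hmem : ∀ y : Fin (n + 1) → I, y 0 ∈ V.map g → (fun i => y (Fin.succ i)) ∈ C.map f →
          y ∈ (C ⊔ V).map F := by
        rintro y ⟨v, hv, hvy⟩ ⟨c, hc, hcy⟩
        refine ⟨c + v, Submodule.add_mem_sup hc hv, ?_⟩
        funext i
        refine Fin.cases ?_ (fun i => ?_) i
        · rw [hF0, map_add, hgC c hc, zero_add, hvy]
        · rw [hFs, map_add, hfV v hv, add_zero, hcy]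
      -- Essentiality in two moves: first multiply the tail into the image of C, then multiply the
      -- head into the image of V.
      have hstep : ∀ y : Fin (n + 1) → I, y ≠ 0 → (fun i => y (Fin.succ i)) ∈ C.map f →
          ∃ a : A, a • y ≠ 0 ∧ a • y ∈ (C ⊔ V).map F := by
        intro y hy hyC
        by_cases h0 : y 0 = 0
        · exact ⟨1, by simpa using hy, by simpa using hmem y (by simp [h0]) hyC⟩
        · obtain ⟨a, ha, haV⟩ := hgVe _ h0
          exact ⟨a, fun h => ha (congrFun h 0), hmem _ haV ((C.map f).smul_mem a hyC)⟩
      intro y hy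
      by_cases hs : (fun i => y (Fin.succ i)) = 0
      · exact hstep y hy (by rw [hs]; exact Submodule.zero_mem _)
      · obtain ⟨a, ha, haC⟩ := hC _ hs
        obtain ⟨b, hb, hbF⟩ := hstep (a • y)
          (fun h => ha (funext fun i => congrFun h (Fin.succ i))) haC
        exact ⟨b * a, by rwa [mul_smul], by rwa [mul_smul]⟩
    · exact left_lt_sup.2 fun hle => hV (hCV.symm.eq_bot_of_le hle)
  · obtain ⟨a, ha, haC⟩ := hC x hx
    exact ⟨a, ha, LinearMap.map_le_range haC⟩

end Hull

end NoethAlg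

namespace NoethAlg

/-! ### Nonsingularity of Λ/P and its uniform submodules. -/

section PrimeQuotient

open MulOpposite

variable {Λ : Type u} [Ring Λ] {P : TwoSidedIdeal Λ}

theorem mkQ_eq_zero {x : Λ} : (rightSubmodule P).mkQ x = 0 ↔ x ∈ P := by
  rw [Submodule.mkQ_apply, Submodule.Quotient.mk_eq_zero]
  rfl

theorem smul_mkQ (a : Λᵐᵒᵖ) (x : Λ) :
    a • (rightSubmodule P).mkQ x = (rightSubmodule P).mkQ (x * a.unop) := rfl

theorem nontrivial_quotient (hP : P ≠ ⊤) : Nontrivial (Λ ⧸ rightSubmodule P) := by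
  refine ⟨(rightSubmodule P).mkQ 1, 0, fun h => hP ?_⟩
  exact (TwoSidedIdeal.one_mem_iff P).1 (mkQ_eq_zero.1 h)

/-- A prime right noetherian ring is right nonsingular. -/
theorem IsPrimeIdeal.nonsingular [IsNoetherian Λᵐᵒᵖ Λ] (hP : IsPrimeIdeal P) {b : Λ}
    (hb : b ∉ P) : ∃ y, y ∉ P ∧ ∀ c, y * c ∉ P → b * (y * c) ∉ P := by
  by_contra! hS
  let r : Λ → Submodule Λᵐᵒᵖ Λ := fun z =>
    { carrier := {x | z * x ∈ P}
      add_mem' := fun {x y} hx hy => by simpa [mul_add] using P.add_mem hx hy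
      zero_mem' := by simp [P.zero_mem]
      smul_mem' := fun c x hx => by
        simpa [mul_assoc] using P.mul_mem_right (z * x) c.unop hx }
  have hr : ∀ z x, x ∈ r z ↔ z * x ∈ P := fun z x => Iff.rfl
  -- Among elements outside P whose right annihilator modulo P is essential, take z with maximal
  -- annihilator. If z * x * z ∉ P, it is again such an element, with strictly larger annihilator;
  -- hence zΛz ⊆ P.
  obtain ⟨_, ⟨z, hz, hzS, rfl⟩, hmax⟩ := set_has_maximal_iff_noetherian.2
    ‹IsNoetherian Λᵐᵒᵖ Λ›
    {K | ∃ z, z ∉ P ∧ (∀ y, y ∉ P → ∃ c, y * c ∉ P ∧ z * (y * c) ∈ P) ∧ r z = K}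
    ⟨r b, b, hb, hS, rfl⟩
  suffices h : ∀ x, z * x * z ∈ P from (hP.2 z z h).elim hz hz
  intro x
  by_contra hx
  refine hmax _ ⟨z * x * z, hx, fun y hy => ?_, rfl⟩ ?_
  · by_cases h : x * z * y ∈ P
    · exact ⟨1, by simpa using hy, by simpa [mul_assoc] using P.mul_mem_left z _ h⟩
    · obtain ⟨c, hc, hzc⟩ := hzS _ h
      refine ⟨c, fun h' => hc ?_, by simpa [mul_assoc] using hzc⟩
      simpa [mul_assoc] using P.mul_mem_left (x * z) _ h'
  · refine lt_of_le_of_ne (fun y hy => ?_) fun h => ?_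
    · rw [hr] at hy ⊢
      simpa [mul_assoc] using P.mul_mem_left (z * x) _ hy
    · have hxz : x * z ∉ P := fun h' => hx (by simpa [mul_assoc] using P.mul_mem_left z _ h')
      obtain ⟨c, hc, hzc⟩ := hzS _ hxz
      have hcr : c ∈ r (z * x * z) := by
        rw [hr]
        simpa [mul_assoc] using hzc
      rw [← h, hr] at hcr
      exact hc (by simpa [mul_assoc] using P.mul_mem_left x _ hcr)

/-- If l maps to the class of u under an embedding into U/N, then everything multiplying u into N
annihilates l. Since N is essential in U, this annihilator is too large for nonsingularity. -/
theorem IsPrimeIdeal.isMonoform_of_isUniform [IsNoetherian Λᵐᵒᵖ Λ] (hP : IsPrimeIdeal P)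
    {U : Submodule Λᵐᵒᵖ (Λ ⧸ rightSubmodule P)} (hU : U ≠ ⊥) (hu : IsUniform Λᵐᵒᵖ U) :
    IsMonoform Λᵐᵒᵖ U := by
  refine ⟨Submodule.nontrivial_iff_ne_bot.2 hU, fun N hN hc => ?_⟩
  obtain ⟨L, hL, f, hf⟩ := hasCommonSub_iff_exists_injective.1 hc
  obtain ⟨l, hl, hl0⟩ := L.exists_mem_ne_zero_of_ne_bot hL
  obtain ⟨u, hfu⟩ := N.mkQ_surjective (f ⟨l, hl⟩)
  obtain ⟨l', hl'⟩ := (rightSubmodule P).mkQ_surjective l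
  obtain ⟨u', hu'⟩ := (rightSubmodule P).mkQ_surjective u
  have hl'P : l' ∉ P := fun h => hl0 (Subtype.ext (by rw [← hl', mkQ_eq_zero.2 h]; rfl))
  obtain ⟨y, hy, hyc⟩ := hP.nonsingular hl'P
  have hmem : ∀ x : Λ, op x • u ∈ N → l' * x ∈ P := by
    intro x hx
    have h1 : f (op x • ⟨l, hl⟩) = 0 := by
      rw [map_smul, ← hfu, ← map_smul, Submodule.mkQ_apply, Submodule.Quotient.mk_eq_zero]
      exact hx
    have h2 : op x • (⟨l, hl⟩ : L) = 0 := hf (by rw [h1, map_zero])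
    have h3 : op x • (l : Λ ⧸ rightSubmodule P) = 0 :=
      congrArg (fun t : L => ((t : U) : Λ ⧸ rightSubmodule P)) h2
    rw [← hl', smul_mkQ] at h3
    exact mkQ_eq_zero.1 h3
  by_cases h0 : op y • u = 0
  · exact hyc 1 (by simpa using hy) (by simpa using hmem y (by rw [h0]; exact N.zero_mem))
  · obtain ⟨c, hc0, hcN⟩ := hu N hN _ h0
    have key : c • op y • u = op (y * c.unop) • u := by
      rw [smul_smul, op_mul, op_unop]
    rw [key] at hc0 hcN
    refine hyc c.unop (fun h => hc0 (Subtype.ext ?_)) (hmem _ hcN)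
    change op (y * c.unop) • (u : Λ ⧸ rightSubmodule P) = 0
    rw [← hu', smul_mkQ, mkQ_eq_zero]
    exact P.mul_mem_left _ _ h

/-- Take m in U and k in K, both nonzero. Primeness gives x with mxk ∉ P, and left multiplication by
mx maps Λ/P into U. Nonsingularity at mxk gives y such that this map is injective on V = kyΛ. -/
theorem IsPrimeIdeal.exists_submodule_embedding [IsNoetherian Λᵐᵒᵖ Λ] (hP : IsPrimeIdeal P)
    {U K : Submodule Λᵐᵒᵖ (Λ ⧸ rightSubmodule P)} (hU : U ≠ ⊥) (hK : K ≠ ⊥) :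
    ∃ V ≤ K, V ≠ ⊥ ∧ ∃ e : V →ₗ[Λᵐᵒᵖ] U, Function.Injective e := by
  obtain ⟨m, hm, hm0⟩ := U.exists_mem_ne_zero_of_ne_bot hU
  obtain ⟨k, hk, hk0⟩ := K.exists_mem_ne_zero_of_ne_bot hK
  obtain ⟨m, rfl⟩ := (rightSubmodule P).mkQ_surjective m
  obtain ⟨k, rfl⟩ := (rightSubmodule P).mkQ_surjective k
  rw [Ne, mkQ_eq_zero] at hm0 hk0
  obtain ⟨x, hx⟩ : ∃ x, m * x * k ∉ P := by
    by_contra! h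
    exact (hP.2 m k h).elim hm0 hk0
  obtain ⟨y, hy, hyc⟩ := hP.nonsingular hx
  have hmx : (rightSubmodule P).mkQ (m * x) ∈ U := U.smul_mem (op x) hm
  let g : (Λ ⧸ rightSubmodule P) →ₗ[Λᵐᵒᵖ] (Λ ⧸ rightSubmodule P) :=
    (rightSubmodule P).mapQ (rightSubmodule P)
      { toFun := fun z => m * x * z
        map_add' := fun a b => mul_add _ a b
        map_smul' := fun a b => (mul_assoc (m * x) b a.unop).symm }
      fun z hz => P.mul_mem_left (m * x) z hz
  have hg : ∀ z, g ((rightSubmodule P).mkQ z) = (rightSubmodule P).mkQ (m * x * z) := by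
    intro z
    rfl
  have hgU : ∀ v, g v ∈ U := by
    intro v
    obtain ⟨z, rfl⟩ := (rightSubmodule P).mkQ_surjective v
    rw [hg]
    exact U.smul_mem (op z) hmx
  have hky : k * y ∉ P := by
    intro h
    refine hyc 1 (by simpa using hy) ?_
    simpa [mul_assoc] using P.mul_mem_left (m * x) _ h
  refine ⟨Λᵐᵒᵖ ∙ (rightSubmodule P).mkQ (k * y), ?_, ?_,
    (g.codRestrict U hgU) ∘ₗ Submodule.subtype _, ?_⟩
  · rw [Submodule.span_singleton_le_iff_mem]
    exact K.smul_mem (op y) hk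
  · rw [Ne, Submodule.span_singleton_eq_bot, mkQ_eq_zero]
    exact hky
  · rw [injective_iff_map_eq_zero]
    rintro ⟨v, hv⟩ hv0
    obtain ⟨a, rfl⟩ := Submodule.mem_span_singleton.1 hv
    have h1 : g (a • (rightSubmodule P).mkQ (k * y)) = 0 := congrArg Subtype.val hv0
    rw [smul_mkQ, hg, mkQ_eq_zero] at h1
    refine Subtype.ext ?_
    change a • (rightSubmodule P).mkQ (k * y) = 0
    rw [smul_mkQ, mkQ_eq_zero]
    by_contra h2
    refine hyc a.unop (fun h3 => h2 ?_) (by simpa [mul_assoc] using h1)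
    simpa [mul_assoc] using P.mul_mem_left k _ h3

end PrimeQuotient

/-! ### The atom attached to a prime ideal. -/

section PrimeAtom

variable {Λ : Type u} [Ring Λ]

theorem exists_lift_of_range_le {A : Type u} [Ring A] {V H X : Type u} [AddCommGroup V]
    [Module A V] [AddCommGroup H] [Module A H] [AddCommGroup X] [Module A X] (f : H →ₗ[A] X)
    (hf : Function.Injective f) (φ : V →ₗ[A] X) (hφ : Function.Injective φ)
    (h : ∀ v, φ v ∈ LinearMap.range f) : ∃ ψ : V →ₗ[A] H, Function.Injective ψ :=
  ⟨(LinearEquiv.ofInjective f hf).symm.toLinearMap ∘ₗ φ.codRestrict _ h,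
    (LinearEquiv.ofInjective f hf).symm.injective.comp
      fun _ _ hxy => hφ (congrArg Subtype.val hxy)⟩

theorem hasCommonSub_of_embeddings {A : Type u} [Ring A] {V H X : Type u} [AddCommGroup V]
    [Module A V] [AddCommGroup H] [Module A H] [AddCommGroup X] [Module A X] [Nontrivial V]
    {f : V →ₗ[A] H} (hf : Function.Injective f) {g : V →ₗ[A] X} (hg : Function.Injective g) :
    HasCommonSub A H X := by
  refine hasCommonSub_iff_exists_injective.2 ⟨LinearMap.range f, ?_,
    g ∘ₗ (LinearEquiv.ofInjective f hf).symm.toLinearMap,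
    hg.comp (LinearEquiv.ofInjective f hf).symm.injective⟩
  rw [Ne, LinearMap.range_eq_bot]
  rintro rfl
  obtain ⟨v, hv⟩ := exists_ne (0 : V)
  exact hv (hf rfl)

/-- A prime ideal `P` corresponds to the atom of any uniform submodule of `Λ ⧸ P`. -/
theorem exists_submodule_atomCorresponds_iff [IsNoetherian Λᵐᵒᵖ Λ] (P : PrimeSpec Λ) :
    ∃ (U : Submodule Λᵐᵒᵖ (Λ ⧸ rightSubmodule P.1)) (hU : IsMonoform Λᵐᵒᵖ U),
      ∀ α, AtomCorresponds P α ↔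
        α = MonoformModule.atom ⟨ModuleCat.of Λᵐᵒᵖ U, hU⟩ := by
  obtain ⟨P, hP⟩ := P
  have := nontrivial_quotient hP.1
  obtain ⟨U, hU, hu⟩ := exists_uniform_submodule (A := Λᵐᵒᵖ) (Λ ⧸ rightSubmodule P)
  have hmono := hP.isMonoform_of_isUniform hU hu
  refine ⟨U, hmono, fun α => ⟨?_, ?_⟩⟩
  · rintro ⟨I, ⟨-, -, n, hn⟩, H, rfl, hH⟩
    obtain ⟨-, g, hg, hge⟩ := isInjectiveHull_iff.1 hn
    obtain ⟨-, f, hf, -⟩ := isInjectiveHull_iff.1 hH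
    have hHn := H.2.1
    obtain ⟨h, hh⟩ := exists_ne (0 : H.1)
    obtain ⟨z, hz⟩ := exists_ne (0 : Λ ⧸ rightSubmodule P)
    -- Any index will do: Λ/P ≠ 0 only serves to show that the power of I is not empty.
    obtain ⟨i, -⟩ := Function.ne_iff.1 ((map_ne_zero_iff g hg).2 hz)
    let s : H.1 →ₗ[Λᵐᵒᵖ] (Fin n → I) := LinearMap.single Λᵐᵒᵖ (fun _ => (I : Type u)) i ∘ₗ f
    have hs : Function.Injective s := (Pi.single_injective i).comp hf
    -- Essentiality of Λ/P gives m ≠ 0 in it with the same image as a multiple of h in H. A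
    -- submodule of the span of m that embeds in U then embeds in H as well.
    obtain ⟨a, ha, m, hm⟩ := hge _ ((map_ne_zero_iff s hs).2 hh)
    have hm0 : m ≠ 0 := by
      rintro rfl
      exact ha (by rw [← hm, map_zero])
    obtain ⟨V, hV, hV0, e, he⟩ := hP.exists_submodule_embedding hU
      (K := Λᵐᵒᵖ ∙ m) (by rwa [Ne, Submodule.span_singleton_eq_bot])
    obtain ⟨ψ, hψ⟩ := exists_lift_of_range_le s hs (g ∘ₗ V.subtype)
      (hg.comp V.injective_subtype) (by
        rintro ⟨v, hv⟩
        obtain ⟨b, rfl⟩ := Submodule.mem_span_singleton.1 (hV hv)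
        refine ⟨b • a • h, ?_⟩
        rw [map_smul, map_smul, ← hm]
        simp)
    have := Submodule.nontrivial_iff_ne_bot.2 hV0
    exact Quotient.sound (s := atomSetoid Λᵐᵒᵖ) (hasCommonSub_of_embeddings hψ he)
  · rintro rfl
    obtain ⟨I, hI⟩ := exists_isInjectiveHull (A := Λᵐᵒᵖ) U
    obtain ⟨hinj, f, hf, hfe⟩ := isInjectiveHull_iff.1 hI
    have hIu := hu.of_essential hf hfe
    have := hmono.1
    have : Nontrivial I := hf.nontrivial
    refine ⟨I, ⟨hinj, hIu.isIndecomposable, exists_isInjectiveHull_pi hinj hIu fun K hK => ?_⟩,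
      _, rfl, hI⟩
    obtain ⟨V, hVK, hV, e, he⟩ := hP.exists_submodule_embedding hU hK
    exact ⟨V, hVK, hV, f ∘ₗ e, hf.comp he⟩

end PrimeAtom

end NoethAlg

namespace NoethAlg

/-! ### Simple modules and their annihilators. -/

section SimpleModules

open MulOpposite

variable {Λ : Type u} [Ring Λ]

/-- The annihilator of a right module, as a two-sided ideal. -/
def annihilatorIdeal (S : Type u) [AddCommGroup S] [Module Λᵐᵒᵖ S] : TwoSidedIdeal Λ :=
  TwoSidedIdeal.mk' {x | ∀ s : S, op x • s = 0}
    (fun s => by simp)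
    (fun {x y} hx hy s => by simp [add_smul, hx s, hy s])
    (fun {x} hx s => by simp [hx s])
    (fun {x y} hy s => by rw [op_mul, mul_smul]; exact hy _)
    (fun {x y} hx s => by rw [op_mul, mul_smul, hx s, smul_zero])

theorem mem_annihilatorIdeal {S : Type u} [AddCommGroup S] [Module Λᵐᵒᵖ S] {x : Λ} :
    x ∈ annihilatorIdeal S ↔ ∀ s : S, op x • s = 0 :=
  TwoSidedIdeal.mem_mk' ..

theorem annihilatorIdeal_le_of_injective {S T : Type u} [AddCommGroup S] [Module Λᵐᵒᵖ S]
    [AddCommGroup T] [Module Λᵐᵒᵖ T] (f : S →ₗ[Λᵐᵒᵖ] T) (hf : Function.Injective f) :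
    annihilatorIdeal T ≤ annihilatorIdeal (Λ := Λ) S := fun x hx =>
  mem_annihilatorIdeal.2 fun s => hf (by
    rw [map_smul, mem_annihilatorIdeal.1 hx, map_zero])

theorem annihilatorIdeal_ne_top {S : Type u} [AddCommGroup S] [Module Λᵐᵒᵖ S] [Nontrivial S] :
    annihilatorIdeal (Λ := Λ) S ≠ ⊤ := by
  intro h
  obtain ⟨s, hs⟩ := exists_ne (0 : S)
  have := mem_annihilatorIdeal.1 ((TwoSidedIdeal.one_mem_iff _).2 h) s
  exact hs (by simpa using this)

/-- A nonzero module embedding in a power of a simple module `S` contains a copy of `S`. -/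
theorem exists_submodule_equiv_simple {A : Type u} [Ring A] {M S : Type u} [AddCommGroup M]
    [Module A M] [AddCommGroup S] [Module A S] [IsSimpleModule A S] [Nontrivial M] {ι : Type*}
    [Finite ι] (g : M →ₗ[A] (ι → S)) (hg : Function.Injective g) :
    ∃ W : Submodule A M, Nonempty (W ≃ₗ[A] S) := by
  have := IsSemisimpleModule.of_injective g hg
  obtain ⟨W, hW⟩ := IsSemisimpleModule.exists_simple_submodule A M
  have := IsSimpleModule.nontrivial A W
  obtain ⟨w, hw⟩ := exists_ne (0 : W)
  have hgw : g w ≠ 0 := (map_ne_zero_iff g hg).2 fun h => hw (Subtype.ext h)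
  obtain ⟨i, hi⟩ := Function.ne_iff.1 hgw
  exact ⟨W, ⟨LinearEquiv.ofBijective (LinearMap.proj i ∘ₗ g ∘ₗ W.subtype)
    (LinearMap.bijective_of_ne_zero fun h => hi (LinearMap.congr_fun h w))⟩⟩

/-- A simple quotient of Λ/P works, because P, being two-sided, annihilates Λ/P. For maximal P the
inclusion becomes an equality. -/
theorem exists_simple_annihilatorIdeal_ge [IsNoetherian Λᵐᵒᵖ Λ] {P : TwoSidedIdeal Λ}
    (hP : P ≠ ⊤) : ∃ S : ModuleCat.{u} Λᵐᵒᵖ, IsSimpleModule Λᵐᵒᵖ S ∧ P ≤ annihilatorIdeal S := by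
  have := nontrivial_quotient hP
  have hfg : Module.Finite Λᵐᵒᵖ (Λ ⧸ rightSubmodule P) := inferInstance
  obtain ⟨N, hN, -⟩ := (eq_top_or_exists_le_coatom
    (⊥ : Submodule Λᵐᵒᵖ (Λ ⧸ rightSubmodule P))).resolve_left bot_ne_top
  refine ⟨ModuleCat.of Λᵐᵒᵖ ((Λ ⧸ rightSubmodule P) ⧸ N), isSimpleModule_iff_isCoatom.2 hN,
    fun x hx => mem_annihilatorIdeal.2 fun s => ?_⟩
  obtain ⟨s, rfl⟩ := N.mkQ_surjective s
  obtain ⟨s, rfl⟩ := (rightSubmodule P).mkQ_surjective s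
  change N.mkQ (op x • _) = 0
  rw [smul_mkQ, mkQ_eq_zero.2 (P.mul_mem_left _ (op x).unop hx), map_zero]

section FiniteAlgebra

variable (R : Type v) [CommRing R] [Algebra R Λ]

/-- For a simple module `S` over a finite algebra, `Λ ⧸ ann S` embeds in a finite power of `S`. -/
theorem exists_embedding_pi_of_simple [Module.Finite R Λ] (S : Type u) [AddCommGroup S]
    [Module Λᵐᵒᵖ S] [IsSimpleModule Λᵐᵒᵖ S] :
    ∃ (t : Finset Λ) (g : (Λ ⧸ rightSubmodule (annihilatorIdeal (Λ := Λ) S)) →ₗ[Λᵐᵒᵖ] (t → S)),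
      Function.Injective g := by
  obtain ⟨t, ht⟩ := Module.Finite.fg_top (R := R) (M := Λ)
  have := IsSimpleModule.nontrivial Λᵐᵒᵖ S
  obtain ⟨s, hs⟩ := exists_ne (0 : S)
  -- With t generating Λ over R, the map x ↦ (s·i·x) has kernel ann S: R is central, so x kills s·Λ
  -- as soon as it kills each s·i, and s·Λ = S.
  let g₀ : Λ →ₗ[Λᵐᵒᵖ] (t → S) :=
    { toFun := fun x i => op (i * x) • s
      map_add' := fun x y => by
        funext i
        simp [mul_add, add_smul]
      map_smul' := fun a x => by
        funext i
        simp [mul_smul] }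
  have hker : ∀ x, g₀ x = 0 ↔ x ∈ annihilatorIdeal S := by
    intro x
    rw [mem_annihilatorIdeal]
    constructor
    · intro hx s'
      obtain ⟨a, rfl⟩ := IsSimpleModule.toSpanSingleton_surjective Λᵐᵒᵖ hs s'
      have hspan : ∀ y ∈ Submodule.span R (t : Set Λ), op (y * x) • s = 0 := by
        intro y hy
        induction hy using Submodule.span_induction with
        | mem y hy => exact congrFun hx ⟨y, hy⟩
        | zero => simp
        | add y z _ _ hy hz => rw [add_mul, op_add, add_smul, hy, hz, add_zero]
        | smul r y _ hy =>
          rw [Algebra.smul_def, mul_assoc, Algebra.commutes, op_mul, mul_smul, hy, smul_zero]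
      have := hspan a.unop (by rw [ht]; trivial)
      simpa [mul_smul] using this
    · intro hx
      funext i
      change op ((i : Λ) * x) • s = 0
      rw [op_mul, mul_smul, hx]
  refine ⟨t, (rightSubmodule (annihilatorIdeal (Λ := Λ) S)).liftQ g₀ fun x hx => (hker x).2 hx, ?_⟩
  rw [injective_iff_map_eq_zero]
  intro m hm
  obtain ⟨x, rfl⟩ := (rightSubmodule (annihilatorIdeal (Λ := Λ) S)).mkQ_surjective m
  exact mkQ_eq_zero.2 ((hker x).1 hm)

/-- For a proper Q strictly above ann S, the image of Q in the semisimple module Λ/ann S has a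
nonzero complement N, which contains a copy of S. Since N·Q lies both in N and in the image of Q, it
vanishes, so Q annihilates S, a contradiction. -/
theorem isCoatom_annihilatorIdeal [Module.Finite R Λ] (S : Type u) [AddCommGroup S]
    [Module Λᵐᵒᵖ S] [IsSimpleModule Λᵐᵒᵖ S] : IsCoatom (annihilatorIdeal (Λ := Λ) S) := by
  have := IsSimpleModule.nontrivial Λᵐᵒᵖ S
  refine ⟨annihilatorIdeal_ne_top, fun Q hQ => ?_⟩
  by_contra hQt
  obtain ⟨t, g, hg⟩ := exists_embedding_pi_of_simple (Λ := Λ) R S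
  have := IsSemisimpleModule.of_injective g hg
  obtain ⟨N, hN⟩ := exists_isCompl
    ((rightSubmodule Q).map (rightSubmodule (annihilatorIdeal (Λ := Λ) S)).mkQ)
  have hN0 : N ≠ ⊥ := by
    rintro rfl
    have h1 := eq_top_of_isCompl_bot hN
    obtain ⟨q, hq, hq1⟩ := (Submodule.eq_top_iff'.1 h1)
      ((rightSubmodule (annihilatorIdeal (Λ := Λ) S)).mkQ 1)
    have h2 : q - 1 ∈ annihilatorIdeal S := mkQ_eq_zero.1 (by rw [map_sub, hq1, sub_self])
    have h3 : q - (q - 1) ∈ Q := Q.sub_mem hq (hQ.le h2)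
    exact hQt ((TwoSidedIdeal.one_mem_iff Q).1 (by simpa using h3))
  have := Submodule.nontrivial_iff_ne_bot.2 hN0
  obtain ⟨W, ⟨e⟩⟩ := exists_submodule_equiv_simple (g ∘ₗ N.subtype) (hg.comp N.injective_subtype)
  have he : Function.Injective e.symm.toLinearMap := e.symm.injective
  refine hQ.not_ge (le_trans (fun q hq => ?_) (annihilatorIdeal_le_of_injective (S := S) (T := W) (e.symm : S →ₗ[Λᵐᵒᵖ] W) he))
  refine mem_annihilatorIdeal.2 fun w => Subtype.ext (Subtype.ext ?_)
  refine Submodule.disjoint_def.1 hN.disjoint _ ?_ (op q • w : W).1.2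
  obtain ⟨x, hx⟩ := (rightSubmodule (annihilatorIdeal (Λ := Λ) S)).mkQ_surjective
    ((w : N) : Λ ⧸ rightSubmodule (annihilatorIdeal (Λ := Λ) S))
  refine ⟨x * q, Q.mul_mem_left x q hq, ?_⟩
  change _ = op q • ((w : N) : Λ ⧸ rightSubmodule (annihilatorIdeal (Λ := Λ) S))
  rw [← hx, smul_mkQ, unop_op]

end FiniteAlgebra

end SimpleModules

/-! ### Atoms of simple modules and maximal ideals. -/

section MaximalIdeals

variable {Λ : Type u} [Ring Λ]

theorem equiv_of_hasCommonSub {A : Type u} [Ring A] {S T : Type u} [AddCommGroup S] [Module A S]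
    [AddCommGroup T] [Module A T] [IsSimpleModule A S] [IsSimpleModule A T]
    (h : HasCommonSub A S T) : Nonempty (S ≃ₗ[A] T) := by
  obtain ⟨L, hL, f, hf⟩ := hasCommonSub_iff_exists_injective.1 h
  obtain rfl := (eq_bot_or_eq_top L).resolve_left hL
  have := Submodule.nontrivial_iff_ne_bot.2 hL
  obtain ⟨x, hx⟩ := exists_ne (0 : (⊤ : Submodule A S))
  refine ⟨LinearEquiv.ofBijective (f ∘ₗ Submodule.topEquiv.symm.toLinearMap)
    (LinearMap.bijective_of_ne_zero fun h0 => ?_)⟩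
  have := LinearMap.congr_fun h0 (Submodule.topEquiv x)
  exact (map_ne_zero_iff f hf).2 hx this

theorem SimpleClass.atom_injective {A : Type u} [Ring A] :
    Function.Injective (SimpleClass.atom (A := A)) := by
  rintro ⟨S⟩ ⟨T⟩ h
  have := S.2
  have := T.2
  exact Quotient.sound (s := simpleSetoid A) (equiv_of_hasCommonSub (Quotient.exact h))

/-- The simple module with annihilator `P` represents the atom attached to `P`. -/
theorem atom_eq_of_annihilatorIdeal (R : Type v) [CommRing R] [Algebra R Λ] [Module.Finite R Λ]
    (S : ModuleCat.{u} Λᵐᵒᵖ) (hS : IsSimpleModule Λᵐᵒᵖ S)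
    (U : Submodule Λᵐᵒᵖ (Λ ⧸ rightSubmodule (annihilatorIdeal (Λ := Λ) S)))
    (hU : IsMonoform Λᵐᵒᵖ U) :
    MonoformModule.atom ⟨ModuleCat.of Λᵐᵒᵖ U, hU⟩ =
      MonoformModule.atom ⟨S, isMonoform_of_isSimpleModule hS⟩ := by
  obtain ⟨t, g, hg⟩ := exists_embedding_pi_of_simple (Λ := Λ) R S
  have := hU.1
  obtain ⟨W, ⟨e⟩⟩ := exists_submodule_equiv_simple (g ∘ₗ U.subtype) (hg.comp U.injective_subtype)
  have := IsSimpleModule.nontrivial Λᵐᵒᵖ S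
  have := e.toEquiv.nontrivial
  have he : Function.Injective e.toLinearMap := e.injective
  exact Quotient.sound (s := atomSetoid Λᵐᵒᵖ) (hasCommonSub_of_embeddings (V := W) (H := U) (X := S) W.injective_subtype
      (g := (e : W →ₗ[Λᵐᵒᵖ] S)) he)

end MaximalIdeals

end NoethAlg

theorem mainTheorem9 (R : Type v) [CommRing R] [IsNoetherianRing R]
    (Λ : Type u) [Ring Λ] [Algebra R Λ] [Module.Finite R Λ] :
    ∃ tilde : NoethAlg.PrimeSpec Λ → NoethAlg.ASpec Λᵐᵒᵖ,
      (∀ (P : NoethAlg.PrimeSpec Λ) (α : NoethAlg.ASpec Λᵐᵒᵖ),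
        NoethAlg.AtomCorresponds P α ↔ α = tilde P) ∧
      Set.BijOn (fun P : NoethAlg.MaxSpec Λ => tilde P.toPrimeSpec)
        Set.univ (NoethAlg.simpleAtoms Λᵐᵒᵖ) ∧
      ∃ φ : NoethAlg.MaxSpec Λ ≃ NoethAlg.SimpleClass Λᵐᵒᵖ,
        ∀ P : NoethAlg.MaxSpec Λ, (φ P).atom = tilde P.toPrimeSpec := by
  have : IsNoetherian R Λ := isNoetherian_of_isNoetherianRing_of_finite R Λ
  have : IsNoetherian Λᵐᵒᵖ Λ := isNoetherian_of_tower R this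
  -- The map `tilde` will be the atom of the chosen submodule U P of Λ/P.
  choose U hU hcorr using NoethAlg.exists_submodule_atomCorresponds_iff (Λ := Λ)
  have hsimple : ∀ (P : NoethAlg.MaxSpec Λ) (S : ModuleCat.{u} Λᵐᵒᵖ)
      (hS : IsSimpleModule Λᵐᵒᵖ S), P.1 = NoethAlg.annihilatorIdeal S →
      NoethAlg.MonoformModule.atom ⟨ModuleCat.of Λᵐᵒᵖ (U P.toPrimeSpec), hU P.toPrimeSpec⟩ =
        NoethAlg.MonoformModule.atom ⟨S, NoethAlg.isMonoform_of_isSimpleModule hS⟩ := by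
    rintro ⟨P, hP⟩ S hS rfl
    exact NoethAlg.atom_eq_of_annihilatorIdeal R S hS _ _
  have hex : ∀ P : NoethAlg.MaxSpec Λ, ∃ (S : ModuleCat.{u} Λᵐᵒᵖ)
      (_ : IsSimpleModule Λᵐᵒᵖ S), P.1 = NoethAlg.annihilatorIdeal S := by
    intro P
    obtain ⟨S, hS, hPS⟩ := NoethAlg.exists_simple_annihilatorIdeal_ge P.2.1
    have := IsSimpleModule.nontrivial Λᵐᵒᵖ S
    refine ⟨S, hS, (P.2.le_iff_eq NoethAlg.annihilatorIdeal_ne_top).1 hPS |>.symm⟩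
  have hbij : Set.BijOn (fun P : NoethAlg.MaxSpec Λ => NoethAlg.MonoformModule.atom
      ⟨ModuleCat.of Λᵐᵒᵖ (U P.toPrimeSpec), hU P.toPrimeSpec⟩)
      Set.univ (NoethAlg.simpleAtoms Λᵐᵒᵖ) := by
    refine ⟨fun P _ => ?_, fun P _ Q _ hPQ => ?_, ?_⟩
    · obtain ⟨S, hS, hPS⟩ := hex P
      exact ⟨⟨S, NoethAlg.isMonoform_of_isSimpleModule hS⟩, hS, (hsimple P S hS hPS).symm⟩
    · obtain ⟨S, hS, hPS⟩ := hex P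
      obtain ⟨T, hT, hQT⟩ := hex Q
      have h : NoethAlg.MonoformModule.atom _ = NoethAlg.MonoformModule.atom _ :=
        (hsimple P S hS hPS).symm.trans (Eq.trans hPQ (hsimple Q T hT hQT))
      -- Atom-equivalent simple modules are isomorphic, hence have the same annihilator, and P and Q
      -- are these annihilators.
      obtain ⟨e⟩ := NoethAlg.equiv_of_hasCommonSub (Quotient.exact h)
      refine Subtype.ext ?_
      rw [hPS, hQT]
      exact le_antisymm
        (NoethAlg.annihilatorIdeal_le_of_injective e.symm.toLinearMap e.symm.injective)
        (NoethAlg.annihilatorIdeal_le_of_injective e.toLinearMap e.injective)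
    · rintro _ ⟨H, hH, rfl⟩
      exact ⟨⟨NoethAlg.annihilatorIdeal H.1, NoethAlg.isCoatom_annihilatorIdeal R H.1⟩,
        trivial, hsimple _ H.1 hH rfl⟩
  refine ⟨_, hcorr, hbij, ?_⟩
  have hlift : ∀ P : NoethAlg.MaxSpec Λ, ∃ C : NoethAlg.SimpleClass Λᵐᵒᵖ,
      C.atom = NoethAlg.MonoformModule.atom
        ⟨ModuleCat.of Λᵐᵒᵖ (U P.toPrimeSpec), hU P.toPrimeSpec⟩ := by
    intro P
    obtain ⟨S, hS, hPS⟩ := hex P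
    exact ⟨Quotient.mk _ ⟨S, hS⟩, (hsimple P S hS hPS).symm⟩
  choose φ hφ using hlift
  refine ⟨Equiv.ofBijective φ ⟨fun P Q hPQ => ?_, fun C => ?_⟩, hφ⟩
  · exact hbij.injOn trivial trivial ((hφ P).symm.trans ((congrArg _ hPQ).trans (hφ Q)))
  · obtain ⟨S⟩ := C
    obtain ⟨P, -, hP⟩ := hbij.surjOn ⟨⟨S.1, NoethAlg.isMonoform_of_isSimpleModule S.2⟩, S.2, rfl⟩
    exact ⟨P, NoethAlg.SimpleClass.atom_injective ((hφ P).trans hP)⟩
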